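/- **Setup.** Let $E$ be a finite non-empty set of $N$ edges, let $\mathcal B$ be a non-empty family of subsets of $E$ and $\ell$ an integer-valued function on subsets of $E$. We use two cases. * $G$ is a finite undirected graph with edge set $E$ (multiple edges and self-loops allowed), $\ell(\gamma)=|\gamma|-|V|+c(\gamma)$ is the loop number, where $c(\gamma)$ is the number of connected components of the graph $(V,\gamma)$, and $\mathcal B$ is the set of spanning forests $T$ ($\ell(T)=0$ and $c(T)=c(E)$; these are the spanning trees if $G$ is connected). * $M$ is a matroid on $E$, $\ell(\gamma)=|\gamma|-\mathrm{rk}(\gamma)$ is the corank, and $\mathcal B$ is the set of bases of $M$. For $d\in\mathbb R$ and indices $a\in\mathbb R^E$ put $\omega_a(\gamma)=\sum_{e\in\gamma}a_e-\frac d2\,\ell(\gamma)$, and assume $\omega_a(E)=0$. The object is called *p-log* (for $d$ and $a$) if in addition $\omega_a(\gamma)>0$ for all $\emptyset\ne\gamma\subsetneq E$. The Hepp bound is $$\mathcal H(a)=\sum_{\sigma}\frac{1}{\omega_a(\{\sigma(1)\})\,\omega_a(\{\sigma(1),\sigma(2)\})\cdots\omega_a(\{\sigma(1),\dots,\sigma(N-1)\})},$$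 summed over all $N!$ orders $\sigma(1),\dots,\sigma(N)$ of $E$ (the empty product is $1$). For $i\in E$ the Hepp integral is $$\mathcal I(a)=\int_{(0,\infty)^{E\setminus\{i\}}}\ \prod_{e\ne i}x_e^{a_e-1}\ \Big(\max_{T\in\mathcal B}\prod_{e\notin T}x_e\Big)^{-d/2}\Big|_{x_i=1}\ \prod_{e\ne i}dx_e .$$ The translated polytope and its polar are $$\mathcal N(a)=a-\tfrac d2\,\mathrm{conv}\{\mathbf 1_{E\setminus T}:T\in\mathcal B\},\qquad \mathcal N(a)^\circ=\bigcap_{T\in\mathcal B}\big\{y\in\mathbb R^E:\ y\cdot(a-\tfrac d2\mathbf 1_{E\setminus T})\le 1\big\}.$$ $\mathrm{Vol}$ of a subset of the hyperplane $\{y_i=0\}\cong\mathbb R^{E\setminus\{i\}}$ denotes $(N-1)$-dimensional Lebesgue measure. **Theorem.** (1) Let $G$ be a finite graph that is p-log for $d=4$ and unit indices $a=(1,\dots,1)$, and let $i\in E$ be any edge. Let $\mathcal N_G^\circ=\bigcap_{T}\{y:\ y\cdot v_T\le 1\}$ be the polar of the spanning tree polytope $\mathrm{conv}\{v_T\}$,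 where $T$ runs over the spanning forests and $v_T$ has entries $+1$ on $T$ and $-1$ off $T$. Then $\mathcal N_G^\circ\cap\{y_i=0\}$ is bounded, the Hepp integral converges absolutely, and $$\mathcal I(1,\dots,1)=\mathcal H(1,\dots,1)=(N-1)!\cdot\mathrm{Vol}\big(\mathcal N_G^\circ\cap\{y_i=0\}\big).$$ (2) Let $M$ be a connected matroid on $E$ (that is, not a direct sum of two non-empty matroids), let $i\in E$, $d\ge 0$, and let $a\in\mathbb R^E$ satisfy $\omega_a(E)=0$. If $M$ is p-log for $d$ and $a$, then $\mathcal N(a)^\circ\cap\{y_i=0\}$ is bounded. Whenever $\mathcal N(a)^\circ\cap\{y_i=0\}$ is bounded, then $\omega_a(\gamma)\neq 0$ for all $\emptyset\ne\gamma\subsetneq E$ (so $\mathcal H(a)$ is well defined), the Hepp integral converges absolutely, and $$\mathcal H(a)=\mathcal I(a)=(N-1)!\cdot\mathrm{Vol}\big(\mathcal N(a)^\circ\cap\{y_i=0\}\big).$$ -/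

import Mathlib

open MeasureTheory

noncomputable section

namespace Hepp

section General

variable {E : Type*} [Fintype E]

/-- The superficial degree of convergence `∑_{e ∈ γ} a_e - (d/2) ℓ(γ)` of a set `γ` of edges,
where `ℓ` is the loop number (corank) function and `d` is the dimension. -/
def sdc (ℓ : Finset E → ℤ) (d : ℝ) (a : E → ℝ) (γ : Finset E) : ℝ :=
  ∑ e ∈ γ, a e - d / 2 * (ℓ γ : ℝ)

/-- Primitive logarithmic divergence: the total degree of convergence vanishes, and that of every
non-empty proper subset is positive. -/
def IsPLog (ℓ : Finset E → ℤ) (d : ℝ) (a : E → ℝ) : Prop :=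
  sdc ℓ d a Finset.univ = 0 ∧
    ∀ γ : Finset E, γ.Nonempty → γ ≠ Finset.univ → 0 < sdc ℓ d a γ

/-- The first `k` elements `{σ(1), …, σ(k)}` in the total order of the edges given by `σ`. -/
def initialSegment (σ : Fin (Fintype.card E) ≃ E) (k : ℕ) : Finset E :=
  Finset.univ.filter fun e => (σ.symm e : ℕ) < k

/-- The combinatorial Hepp bound
`∑_σ 1 / (ω(σ(1)) ω(σ(1),σ(2)) ⋯ ω(σ(1),…,σ(N-1)))`, a sum over all `N!` orders of the edges,
where `ω` is the superficial degree of convergence. -/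
def heppBound [DecidableEq E] (ℓ : Finset E → ℤ) (d : ℝ) (a : E → ℝ) : ℝ :=
  ∑ σ : Fin (Fintype.card E) ≃ E,
    1 / ∏ k ∈ Finset.Ico 1 (Fintype.card E), sdc ℓ d a (initialSegment σ k)

/-- The tropical polynomial `max_{T ∈ B} ∏_{e ∉ T} x_e` of a (non-empty) family `B` of edge sets,
to be used with the spanning forests of a graph or the bases of a matroid. -/
def tropPoly [DecidableEq E] (B : Set (Finset E)) (x : E → ℝ) : ℝ :=
  ⨆ T : B, ∏ e ∈ (T : Finset E)ᶜ, x e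

/-- Extend a vector on `E ∖ {i}` by the value `c` at `i`. -/
def extendBy [DecidableEq E] (c : ℝ) (i : E) (z : {e : E // e ≠ i} → ℝ) : E → ℝ :=
  fun e => if h : e ≠ i then z ⟨e, h⟩ else c

/-- The integrand `∏_{e ≠ i} x_e^{a_e - 1} / (Ψ^trop)^{d/2}` in the chart `x_i = 1`. -/
def mellinIntegrand [DecidableEq E] (B : Set (Finset E)) (d : ℝ) (a : E → ℝ) (i : E)
    (z : {e : E // e ≠ i} → ℝ) : ℝ :=
  (∏ e, z e ^ (a e - 1)) / tropPoly B (extendBy 1 i z) ^ (d / 2)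

/-- The open positive orthant of `ℝ^{E ∖ {i}}`. -/
def positiveOrthant (i : E) : Set ({e : E // e ≠ i} → ℝ) :=
  {z | ∀ e, 0 < z e}

/-- The Hepp bound integral (Mellin transform of the tropical polynomial) in the chart
`x_i = 1`. -/
def heppIntegral [DecidableEq E] (B : Set (Finset E)) (d : ℝ) (a : E → ℝ) (i : E) : ℝ :=
  ∫ z in positiveOrthant i, mellinIntegrand B d a i z

/-- The vertex `a - (d/2) 1_{Tᶜ}` of the Newton polytope. -/
def newtonVertex [DecidableEq E] (d : ℝ) (a : E → ℝ) (T : Finset E) : E → ℝ :=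
  fun e => a e - d / 2 * (if e ∈ T then 0 else 1)

/-- The Newton polytope `a - (d/2) conv {1_{Tᶜ} : T ∈ B}`, as the convex hull of the translated
vectors `a - (d/2) 1_{Tᶜ}`. -/
def newtonPolytope [DecidableEq E] (B : Set (Finset E)) (d : ℝ) (a : E → ℝ) : Set (E → ℝ) :=
  convexHull ℝ (newtonVertex d a '' B)

/-- The polar polyhedron, the intersection of the half-spaces `{y : y · (a - (d/2) 1_{Tᶜ}) ≤ 1}`
over all `T ∈ B`. -/
def polar [DecidableEq E] (B : Set (Finset E)) (d : ℝ) (a : E → ℝ) : Set (E → ℝ) :=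
  {y | ∀ T ∈ B, ∑ e, y e * newtonVertex d a T e ≤ 1}

/-- The polyhedron `polar B d a` is the polar of the Newton polytope. -/
theorem mem_polar_iff [DecidableEq E] (B : Set (Finset E)) (d : ℝ) (a : E → ℝ) (y : E → ℝ) :
    y ∈ polar B d a ↔ ∀ z ∈ newtonPolytope B d a, ∑ e, y e * z e ≤ 1 := by
  constructor
  · intro hy z hz
    have hconv : Convex ℝ {w : E → ℝ | ∑ e, y e * w e ≤ 1} := by
      apply convex_halfSpace_le
      constructor
      · intro u v
        simp [mul_add, Finset.sum_add_distrib]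
      · intro c u
        simp only [Pi.smul_apply, smul_eq_mul, Finset.mul_sum]
        exact Finset.sum_congr rfl fun e _ => by ring
    refine convexHull_min ?_ hconv hz
    rintro _ ⟨T, hT, rfl⟩
    exact hy T hT
  · intro hy T hT
    exact hy _ (subset_convexHull ℝ _ ⟨T, hT, rfl⟩)

/-- The slice `P ∩ {y_i = 0}` viewed inside `{y_i = 0} ≅ ℝ^{E ∖ {i}}`. -/
def slice [DecidableEq E] (P : Set (E → ℝ)) (i : E) : Set ({e : E // e ≠ i} → ℝ) :=
  {z | extendBy 0 i z ∈ P}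

/-- The `(N-1)`-dimensional Lebesgue measure of `P ∩ {y_i = 0}`. -/
def sliceVolume [DecidableEq E] (P : Set (E → ℝ)) (i : E) : ℝ :=
  (volume (slice P i)).toReal

end General

section Graphs

variable {V E : Type*}

/-- The number of connected components of the subgraph of `G` with all vertices of `G` and with
edge set `γ`. -/
def numComponents (G : Graph V E) (γ : Finset E) : ℕ :=
  Nat.card (Quot fun x y : G.vertexSet => ∃ e ∈ γ, G.IsLink e x y)

/-- The loop number (first Betti number) `|γ| - |V| + c(γ)` of a set of edges. -/
def loopNumber (G : Graph V E) (γ : Finset E) : ℤ :=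
  (γ.card : ℤ) - (Nat.card G.vertexSet : ℤ) + (numComponents G γ : ℤ)

/-- The spanning forests of `G`: edge sets without loops that have as many connected components
as `G`. If `G` is connected, then these are the spanning trees. -/
def spanningForests [Fintype E] (G : Graph V E) : Set (Finset E) :=
  {T | loopNumber G T = 0 ∧ numComponents G T = numComponents G Finset.univ}

/-- The vector `v_T` with entry `1` at the edges in `T` and `-1` at all other edges. -/
def signVector [DecidableEq E] (T : Finset E) : E → ℝ :=
  fun e => if e ∈ T then 1 else -1

/-- The polar of the spanning tree polytope `conv {v_T}`, the intersection of the half-spaces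
`{y : y · v_T ≤ 1}`. -/
def graphPolar [Fintype E] [DecidableEq E] (G : Graph V E) : Set (E → ℝ) :=
  {y | ∀ T ∈ spanningForests G, ∑ e, y e * signVector T e ≤ 1}

end Graphs

section Matroids

variable {E : Type*}

/-- The corank `|γ| - rk γ` of a subset of a matroid on a finite type. -/
def corank (M : Matroid E) (γ : Finset E) : ℤ :=
  (γ.card : ℤ) - ((M.eRk (γ : Set E)).toNat : ℤ)

/-- The bases of a matroid on a finite type. -/
def bases (M : Matroid E) : Set (Finset E) :=
  {T | M.IsBase (T : Set E)}

/-- A matroid is connected if it is not the direct sum of two non-empty matroids. -/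
def IsConnected (M : Matroid E) : Prop :=
  ∀ (A B : Matroid E) (h : Disjoint A.E B.E), A.E.Nonempty → B.E.Nonempty →
    M ≠ A.disjointSum B h

end Matroids

end Hepp

end

/-! Let h(y) = max_T y · (a - (d/2) 1_{Tᶜ}) be the support function of the Newton polytope, so that
the polar is {h ≤ 1}. Hepp bound, Hepp integral and volume are three evaluations of the integral of
exp(-h) over the hyperplane y_i = 0.

Integral: the substitution x_e = exp(-y_e) turns the Mellin integrand times its Jacobian into
exp(-h); since d ≥ 0, the power d/2 respects the maximum (`heppIntegral_eq_integral_exp`).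

Volume: h is non-negative and positively homogeneous, so the layer cake formula gives (N-1)! times
the volume of {h ≤ 1} (`lintegral_exp_neg_eq_factorial_mul_volume`).

Hepp bound: up to a null set the hyperplane splits into sectors y_σ(1) > ... > y_σ(N). The greedy
basis for σ is optimal on every initial segment at once, so summation by parts gives h = ∑ u_k
ω(σ(1),...,σ(k)) with u_k = y_σ(k) - y_σ(k+1) (`supportFn_eq_sum`). The coordinates u_k are
unimodular, and each sector contributes 1 / ∏ ω (`lintegral_exp_neg_supportFn`).

All of this needs every ω(γ) > 0, which is equivalent to boundedness of the slice: if ω(γ) ≤ 0, then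
h ≤ 0 on the ray spanned by 1_γ, shifted by a constant into the slice (`isPLog_of_isBounded`). Only
rank axioms enter, so graphs and matroids are treated together. -/

noncomputable section

namespace Hepp

/-! ### Rank functions and the greedy basis of a flag -/

section RankFunction

variable {E : Type*} [DecidableEq E]

/-- Matroid rank functions on finite sets, axiomatised by local conditions. -/
structure IsRankFunction (r : Finset E → ℤ) : Prop where
  empty : r ∅ = 0
  le_insert : ∀ e γ, r γ ≤ r (insert e γ)
  insert_le : ∀ e γ, r (insert e γ) ≤ r γ + 1
  insert_eq_of_subset : ∀ e I J, I ⊆ J → r (insert e I) = r I → r (insert e J) = r J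

namespace IsRankFunction

variable {r : Finset E → ℤ} (hr : IsRankFunction r)
include hr

theorem union_le (A S : Finset E) : r (A ∪ S) ≤ r A + S.card := by
  induction S using Finset.induction_on with
  | empty => simp
  | insert e S he ih =>
    rw [Finset.union_insert, Finset.card_insert_of_notMem he]
    have := hr.insert_le e (A ∪ S)
    push_cast
    linarith

theorem le_union (A S : Finset E) : r A ≤ r (A ∪ S) := by
  induction S using Finset.induction_on with
  | empty => simp
  | insert e S he ih =>
    rw [Finset.union_insert]
    exact ih.trans (hr.le_insert _ _)

theorem mono {A C : Finset E} (h : A ⊆ C) : r A ≤ r C := by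
  simpa [Finset.union_eq_right.2 h] using hr.le_union A C

/-- An independent set meets any set in at most as many elements as its rank. -/
theorem card_inter_le {T : Finset E} (hT : r T = T.card) (γ : Finset E) :
    ((T ∩ γ).card : ℤ) ≤ r γ := by
  have h1 := hr.union_le (T ∩ γ) (T \ γ)
  have h2 : (T ∩ γ) ∪ (T \ γ) = T := by
    ext e; simp only [Finset.mem_union, Finset.mem_inter, Finset.mem_sdiff]; tauto
  have h3 : (T ∩ γ).card + (T \ γ).card = T.card := Finset.card_inter_add_card_sdiff T γ
  rw [h2, hT] at h1
  have h4 := hr.mono (Finset.inter_subset_right : T ∩ γ ⊆ γ)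
  push_cast [← h3] at h1
  linarith

end IsRankFunction

/-- The independent sets of full rank of a rank function. -/
def rankBases [Fintype E] (r : Finset E → ℤ) : Set (Finset E) :=
  {T | r T = T.card ∧ r T = r Finset.univ}

/-- The first `k` elements in the total order given by `σ`. -/
def prefixSet [Fintype E] {N : ℕ} (σ : Fin N ≃ E) (k : ℕ) : Finset E :=
  Finset.univ.filter fun e => (σ.symm e : ℕ) < k

section Prefix

variable [Fintype E] {N : ℕ} (σ : Fin N ≃ E)

omit [DecidableEq E] in
@[simp] theorem mem_prefixSet (k : ℕ) (e : E) : e ∈ prefixSet σ k ↔ (σ.symm e : ℕ) < k := by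
  simp [prefixSet]

omit [DecidableEq E] in
theorem prefixSet_zero : prefixSet σ 0 = ∅ := by
  ext; simp

omit [DecidableEq E] in
theorem prefixSet_of_le {k : ℕ} (h : N ≤ k) : prefixSet σ k = Finset.univ := by
  ext e; simpa using (σ.symm e).2.trans_le h

theorem prefixSet_succ {k : ℕ} (h : k < N) :
    prefixSet σ (k + 1) = insert (σ ⟨k, h⟩) (prefixSet σ k) := by
  ext e
  rw [Finset.mem_insert, mem_prefixSet, mem_prefixSet, ← Equiv.symm_apply_eq, Fin.ext_iff]
  simp only
  omega

/-- The greedy algorithm produces a basis which is simultaneously optimal on all sets of the flag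
given by a total order. -/
theorem IsRankFunction.exists_greedy {r : Finset E → ℤ} (hr : IsRankFunction r) :
    ∃ T ∈ rankBases r, ∀ k ≤ N, ((T ∩ prefixSet σ k).card : ℤ) = r (prefixSet σ k) := by
  -- Keep an element exactly when it raises the rank of the elements before it.
  set T : Finset E := Finset.univ.filter fun e =>
    r (prefixSet σ (σ.symm e)) < r (prefixSet σ (σ.symm e + 1)) with hTdef
  -- The first invariant is optimality on the flag; the second, taken at k = N, makes `T`
  -- independent of full rank.
  have key : ∀ k ≤ N, ((T ∩ prefixSet σ k).card : ℤ) = r (prefixSet σ k) ∧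
      r (T ∩ prefixSet σ k) = r (prefixSet σ k) := by
    intro k
    induction k with
    | zero => intro _; simp [prefixSet_zero, hr.empty]
    | succ k ih =>
      intro hk
      obtain ⟨ih1, ih2⟩ := ih (by omega)
      have hmem : σ ⟨k, hk⟩ ∈ T ↔ r (prefixSet σ k) < r (prefixSet σ (k + 1)) := by
        simp [hTdef]
      have hle := hr.le_insert (σ ⟨k, hk⟩) (prefixSet σ k)
      have hge := hr.insert_le (σ ⟨k, hk⟩) (prefixSet σ k)
      rw [prefixSet_succ σ hk] at hmem ⊢
      by_cases he : σ ⟨k, hk⟩ ∈ T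
      · rw [Finset.inter_insert_of_mem he, Finset.card_insert_of_notMem (by simp)]
        have hlt := hmem.1 he
        have h1 := hr.le_insert (σ ⟨k, hk⟩) (T ∩ prefixSet σ k)
        have h2 := hr.insert_le (σ ⟨k, hk⟩) (T ∩ prefixSet σ k)
        have h3 : r (insert (σ ⟨k, hk⟩) (T ∩ prefixSet σ k)) ≠ r (T ∩ prefixSet σ k) := fun h =>
          hlt.ne' (hr.insert_eq_of_subset _ _ _ Finset.inter_subset_right h)
        push_cast
        omega
      · rw [Finset.inter_insert_of_notMem he]
        have hn : ¬ r (prefixSet σ k) < r (insert (σ ⟨k, hk⟩) (prefixSet σ k)) :=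
          fun h => he (hmem.2 h)
        omega
  refine ⟨T, ?_, fun k hk => (key k hk).1⟩
  have := key N le_rfl
  rw [prefixSet_of_le σ le_rfl, Finset.inter_univ] at this
  exact ⟨by rw [this.2, this.1], this.2⟩

end Prefix

end RankFunction

/-! ### Summation by parts along a total order -/

section Abel

variable {E : Type*} [DecidableEq E] [Fintype E] {n : ℕ}

theorem sum_prefixSet (σ : Fin (n + 1) ≃ E) (v : E → ℝ) (k : ℕ) (hk : k ≤ n + 1) :
    ∑ e ∈ prefixSet σ k, v e =
      ∑ j ∈ Finset.range k, if h : j < n + 1 then v (σ ⟨j, h⟩) else 0 := by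
  induction k with
  | zero => simp [prefixSet_zero]
  | succ k ih =>
    rw [prefixSet_succ σ hk, Finset.sum_insert (by simp), ih (by omega), Finset.sum_range_succ,
      dif_pos (show k < n + 1 from hk), add_comm]

/-- Summation by parts along a total order. -/
theorem sum_mul_eq_sum_prefixSet (σ : Fin (n + 1) ≃ E) (y v : E → ℝ) (hv : ∑ e, v e = 0) :
    ∑ e, y e * v e = ∑ k : Fin n, (y (σ k.castSucc) - y (σ k.succ)) *
      ∑ e ∈ prefixSet σ (k + 1), v e := by
  -- The default 0 outside the range is never reached, and the boundary term vanishes because `v`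
  -- has total sum 0.
  have h0 := Finset.sum_range_by_parts (R := ℝ) (M := ℝ)
    (fun j => if h : j < n + 1 then y (σ ⟨j, h⟩) else 0)
    (fun j => if h : j < n + 1 then v (σ ⟨j, h⟩) else 0) (n + 1)
  rw [← sum_prefixSet σ v (n + 1) le_rfl, prefixSet_of_le σ le_rfl, hv, smul_zero, zero_sub,
    Nat.add_sub_cancel] at h0
  rw [← σ.sum_comp]
  rw [Finset.sum_range] at h0
  rw [Finset.sum_range, ← Finset.sum_neg_distrib] at h0
  convert h0 using 2 with k _ k _
  · rw [dif_pos k.2, dif_pos k.2, smul_eq_mul]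
  · rw [← sum_prefixSet σ v _ (by omega), dif_pos (by omega), dif_pos (by omega), smul_eq_mul,
      ← neg_mul, neg_sub]
    rfl

/-- Differences of values are bounded by the total variation along a total order. -/
theorem abs_sub_le_sum (σ : Fin (n + 1) ≃ E) (y : E → ℝ)
    (hy : ∀ k : Fin n, 0 ≤ y (σ k.castSucc) - y (σ k.succ)) (e e' : E) :
    |y e - y e'| ≤ ∑ k : Fin n, (y (σ k.castSucc) - y (σ k.succ)) := by
  -- The test vector is δ_e - δ_e', whose prefix sums are all -1, 0 or 1.
  have h := sum_mul_eq_sum_prefixSet σ y (fun x => (if x = e then 1 else 0) - if x = e' then 1 else 0)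
    (by simp [Finset.sum_sub_distrib])
  have h1 : ∑ x, y x * ((if x = e then 1 else 0) - if x = e' then 1 else 0) = y e - y e' := by
    simp [mul_sub, Finset.sum_sub_distrib]
  rw [← h1, h]
  refine (Finset.abs_sum_le_sum_abs _ _).trans (Finset.sum_le_sum fun k _ => ?_)
  rw [abs_mul, abs_of_nonneg (hy k)]
  refine mul_le_of_le_one_right (hy k) ?_
  simp only [Finset.sum_sub_distrib, Finset.sum_ite_eq']
  split_ifs <;> simp

omit [DecidableEq E] in
theorem exists_card_eq_succ (i : E) : ∃ n, Fintype.card E = n + 1 :=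
  Nat.exists_eq_succ_of_ne_zero (Fintype.card_pos_iff.2 ⟨i⟩).ne'

omit [DecidableEq E] in
/-- Every function on a finite set is weakly decreasing in some total order. -/
theorem exists_antitone_order (hn : Fintype.card E = n + 1) (y : E → ℝ) :
    ∃ σ : Fin (n + 1) ≃ E, Antitone (y ∘ σ) := by
  let τ := (Fintype.equivFinOfCardEq hn).symm
  refine ⟨(Tuple.sort fun k => -y (τ k)).trans τ, fun j k hjk => ?_⟩
  have := Tuple.monotone_sort (fun k => -y (τ k)) hjk
  simpa using this

end Abel

/-! ### The support function and boundedness of the slice -/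

section SupportFunction

variable {E : Type*} [DecidableEq E] [Fintype E]

/-- The support function `y ↦ max_T y · (a - (d/2) 1_{Tᶜ})` of the Newton polytope. -/
def supportFn (B : Set (Finset E)) (d : ℝ) (a : E → ℝ) (y : E → ℝ) : ℝ :=
  ⨆ T : B, ∑ e, y e * newtonVertex d a T e

theorem le_supportFn {B : Set (Finset E)} (d : ℝ) (a y : E → ℝ) {T : Finset E} (hT : T ∈ B) :
    ∑ e, y e * newtonVertex d a T e ≤ supportFn B d a y :=
  le_ciSup (f := fun T : B => ∑ e, y e * newtonVertex d a T e) (Set.finite_range _).bddAbove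
    ⟨T, hT⟩

theorem supportFn_le_iff {B : Set (Finset E)} (hB : B.Nonempty) (d : ℝ) (a y : E → ℝ) (c : ℝ) :
    supportFn B d a y ≤ c ↔ ∀ T ∈ B, ∑ e, y e * newtonVertex d a T e ≤ c := by
  have := hB.to_subtype
  refine ⟨fun h T hT => (le_supportFn d a y hT).trans h, fun h => ciSup_le fun T => h T T.2⟩

theorem mem_polar_iff_supportFn {B : Set (Finset E)} (hB : B.Nonempty) (d : ℝ) (a y : E → ℝ) :
    y ∈ polar B d a ↔ supportFn B d a y ≤ 1 :=
  (supportFn_le_iff hB d a y 1).symm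

theorem supportFn_smul (B : Set (Finset E)) (d : ℝ) (a y : E → ℝ) {c : ℝ} (hc : 0 ≤ c) :
    supportFn B d a (c • y) = c * supportFn B d a y := by
  rw [supportFn, supportFn, Real.mul_iSup_of_nonneg hc]
  simp [Finset.mul_sum, mul_assoc]

omit [Fintype E] in
theorem sum_newtonVertex (d : ℝ) (a : E → ℝ) (T γ : Finset E) :
    ∑ e ∈ γ, newtonVertex d a T e = ∑ e ∈ γ, a e - d / 2 * ((γ.card : ℝ) - (T ∩ γ).card) := by
  have h : (T ∩ γ).card + (γ \ T).card = γ.card := by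
    rw [Finset.inter_comm]; exact Finset.card_inter_add_card_sdiff γ T
  simp only [newtonVertex, Finset.sum_sub_distrib, ← Finset.mul_sum]
  rw [← h]
  congr 2
  rw [Finset.sum_ite, Finset.sum_const_zero, zero_add, Finset.sum_const, nsmul_one,
    ← Finset.sdiff_eq_filter]
  push_cast
  ring

variable {r : Finset E → ℤ} {ℓ : Finset E → ℤ} {d : ℝ} {a : E → ℝ}

theorem IsRankFunction.rankBases_nonempty (hr : IsRankFunction r) : (rankBases r).Nonempty :=
  let ⟨T, hT, _⟩ := hr.exists_greedy (Fintype.equivFin E).symm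
  ⟨T, hT⟩

/-- An independent `T` omits at least ℓ(γ) elements of γ, and each omission costs d/2 ≥ 0. Equality
holds when T ∩ γ has rk γ elements, as for a greedy basis on its flag. -/
theorem sum_newtonVertex_le_sdc (hr : IsRankFunction r) (hℓ : ∀ γ, ℓ γ = γ.card - r γ)
    (hd : 0 ≤ d) {T : Finset E} (hT : T ∈ rankBases r) (γ : Finset E) :
    ∑ e ∈ γ, newtonVertex d a T e ≤ sdc ℓ d a γ := by
  rw [sum_newtonVertex, sdc, hℓ]
  have h : ((T ∩ γ).card : ℝ) ≤ r γ := by exact_mod_cast hr.card_inter_le hT.1 γ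
  push_cast
  gcongr

omit [Fintype E] in
theorem sum_newtonVertex_eq_sdc (hℓ : ∀ γ, ℓ γ = γ.card - r γ) {T γ : Finset E}
    (h : ((T ∩ γ).card : ℤ) = r γ) : ∑ e ∈ γ, newtonVertex d a T e = sdc ℓ d a γ := by
  rw [sum_newtonVertex, sdc, hℓ, ← h]
  push_cast
  rfl

/-- Hence the support function is invariant under adding a constant to y, and restricting to y_i = 0
loses nothing. -/
theorem sum_newtonVertex_univ (hℓ : ∀ γ, ℓ γ = γ.card - r γ) (h0 : sdc ℓ d a Finset.univ = 0)
    {T : Finset E} (hT : T ∈ rankBases r) : ∑ e, newtonVertex d a T e = 0 := by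
  rw [← h0]
  exact sum_newtonVertex_eq_sdc hℓ (by rw [Finset.inter_univ, ← hT.1, hT.2])

/-- The support function is linear on each sector. -/
theorem supportFn_eq_sum (hr : IsRankFunction r) (hℓ : ∀ γ, ℓ γ = γ.card - r γ) (hd : 0 ≤ d)
    (h0 : sdc ℓ d a Finset.univ = 0) {n : ℕ} (σ : Fin (n + 1) ≃ E) (y : E → ℝ)
    (hy : Antitone (y ∘ σ)) :
    supportFn (rankBases r) d a y = ∑ k : Fin n, (y (σ k.castSucc) - y (σ k.succ)) *
      sdc ℓ d a (prefixSet σ (k + 1)) := by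
  have hu : ∀ k : Fin n, 0 ≤ y (σ k.castSucc) - y (σ k.succ) := fun k =>
    sub_nonneg.2 (hy (Fin.castSucc_le_succ k))
  refine le_antisymm ?_ ?_
  · refine (supportFn_le_iff hr.rankBases_nonempty _ _ _ _).2 fun T hT => ?_
    rw [sum_mul_eq_sum_prefixSet σ y _ (sum_newtonVertex_univ hℓ h0 hT)]
    exact Finset.sum_le_sum fun k _ =>
      mul_le_mul_of_nonneg_left (sum_newtonVertex_le_sdc hr hℓ hd hT _) (hu k)
  · obtain ⟨T, hT, hk⟩ := hr.exists_greedy σ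
    refine le_trans (le_of_eq ?_) (le_supportFn d a y hT)
    rw [sum_mul_eq_sum_prefixSet σ y _ (sum_newtonVertex_univ hℓ h0 hT)]
    refine Finset.sum_congr rfl fun k _ => ?_
    rw [sum_newtonVertex_eq_sdc hℓ (hk _ (by omega))]

omit [DecidableEq E] in
theorem prefixSet_succ_nonempty_ne_univ {n : ℕ} (σ : Fin (n + 1) ≃ E) (k : Fin n) :
    (prefixSet σ (k + 1)).Nonempty ∧ prefixSet σ (k + 1) ≠ Finset.univ := by
  refine ⟨⟨σ 0, by simp⟩, fun h => ?_⟩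
  have : σ (Fin.last n) ∈ prefixSet σ (k + 1) := h ▸ Finset.mem_univ _
  simp at this
  omega

/-- With m > 0 a lower bound for ω on proper non-empty sets, h ≤ 1 bounds the total variation of y
along its sorted order by 1/m. Since y_i = 0, this bounds every coordinate. -/
theorem isBounded_of_isPLog (hr : IsRankFunction r) (hℓ : ∀ γ, ℓ γ = γ.card - r γ) (hd : 0 ≤ d)
    (h : IsPLog ℓ d a) (i : E) :
    Bornology.IsBounded (polar (rankBases r) d a ∩ {y | y i = 0}) := by
  obtain ⟨n, hn⟩ := exists_card_eq_succ i
  obtain ⟨m, hm, hle⟩ : ∃ m > 0, ∀ γ : Finset E, γ.Nonempty → γ ≠ Finset.univ →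
      m ≤ sdc ℓ d a γ := by
    obtain ⟨γ₀, -, hγ₀⟩ := Finset.exists_min_image
      (Finset.univ : Finset (Finset E))
      -- The dummy value 1 keeps the minimum positive and defined even if there is no proper
      -- non-empty subset.
      (fun γ => if γ.Nonempty ∧ γ ≠ Finset.univ then sdc ℓ d a γ else 1) Finset.univ_nonempty
    refine ⟨_, ?_, fun γ hγ hγ' => (hγ₀ γ (Finset.mem_univ _)).trans_eq (if_pos ⟨hγ, hγ'⟩)⟩
    split_ifs with hif
    · exact h.2 γ₀ hif.1 hif.2
    · exact one_pos
  refine (Metric.isBounded_iff_subset_closedBall 0).2 ⟨m⁻¹, fun y ⟨hy, hyi⟩ => ?_⟩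
  rw [mem_polar_iff_supportFn hr.rankBases_nonempty] at hy
  obtain ⟨σ, hσ⟩ := exists_antitone_order hn y
  rw [supportFn_eq_sum hr hℓ hd h.1 σ y hσ] at hy
  have hu : ∀ k : Fin n, 0 ≤ y (σ k.castSucc) - y (σ k.succ) := fun k =>
    sub_nonneg.2 (hσ (Fin.castSucc_le_succ k))
  have hsum : (∑ k : Fin n, (y (σ k.castSucc) - y (σ k.succ))) * m ≤ 1 := by
    refine le_trans ?_ hy
    rw [Finset.sum_mul]
    refine Finset.sum_le_sum fun k _ => mul_le_mul_of_nonneg_left ?_ (hu k)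
    exact hle _ (prefixSet_succ_nonempty_ne_univ σ k).1 (prefixSet_succ_nonempty_ne_univ σ k).2
  rw [mem_closedBall_zero_iff, pi_norm_le_iff_of_nonneg (inv_nonneg.2 hm.le)]
  intro e
  have h1 := abs_sub_le_sum σ y hu e i
  rw [show y i = 0 from hyi, sub_zero] at h1
  rw [Real.norm_eq_abs, ← one_div]
  exact h1.trans ((le_div_iff₀ hm).2 hsum)

theorem isPLog_of_isBounded (hr : IsRankFunction r) (hℓ : ∀ γ, ℓ γ = γ.card - r γ) (hd : 0 ≤ d)
    (h0 : sdc ℓ d a Finset.univ = 0) (i : E)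
    (hb : Bornology.IsBounded (polar (rankBases r) d a ∩ {y | y i = 0})) : IsPLog ℓ d a := by
  refine ⟨h0, fun γ hγ hγ' => ?_⟩
  by_contra! hneg
  obtain ⟨C, hC⟩ := (Metric.isBounded_iff_subset_closedBall 0).1 hb
  let χ : E → ℝ := fun e => if e ∈ γ then 1 else 0
  -- Subtracting χ i puts the ray into the slice; the pairings with the vertices do not change, as
  -- the latter have sum 0.
  have hmem : ∀ t : ℝ, 0 ≤ t → (fun e => t * (χ e - χ i)) ∈
      polar (rankBases r) d a ∩ {y | y i = 0} := by
    intro t ht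
    refine ⟨fun T hT => ?_, by simp⟩
    have h1 : ∑ e, t * (χ e - χ i) * newtonVertex d a T e =
        t * ∑ e ∈ γ, newtonVertex d a T e := by
      simp only [mul_assoc, ← Finset.mul_sum, sub_mul, Finset.sum_sub_distrib,
        sum_newtonVertex_univ hℓ h0 hT, mul_zero, sub_zero]
      simp [χ]
    rw [h1]
    have h2 := sum_newtonVertex_le_sdc (a := a) hr hℓ hd hT γ
    nlinarith
  -- An edge on the other side of γ from i shows that the ray is unbounded.
  obtain ⟨e, he⟩ : ∃ e, |χ e - χ i| = 1 := by
    by_cases hi : i ∈ γ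
    · obtain ⟨e, he⟩ : ∃ e, e ∉ γ := by
        by_contra! h
        exact hγ' (Finset.eq_univ_of_forall h)
      exact ⟨e, by simp [χ, hi, he]⟩
    · obtain ⟨e, he⟩ := hγ
      exact ⟨e, by simp [χ, hi, he]⟩
  have h3 := hC (hmem (|C| + 1) (by positivity))
  rw [mem_closedBall_zero_iff] at h3
  have h4 := (norm_le_pi_norm _ e).trans h3
  rw [Real.norm_eq_abs, abs_mul, he, abs_of_nonneg (by positivity)] at h4
  linarith [le_abs_self C]

end SupportFunction

/-! ### Exponential integrals of homogeneous functions -/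

section LayerCake

variable {ι : Type*} [Fintype ι]

/-- The volume of the sublevel set of a positively homogeneous function in terms of an exponential
integral. -/
theorem lintegral_exp_neg_eq_factorial_mul_volume {g : (ι → ℝ) → ℝ} (hg : Measurable g)
    (hg0 : ∀ x, 0 ≤ g x) (hsmul : ∀ c : ℝ, 0 ≤ c → ∀ x, g (c • x) = c * g x) :
    ∫⁻ x, ENNReal.ofReal (Real.exp (-g x)) =
      ((Fintype.card ι).factorial : ENNReal) * volume {x | g x ≤ 1} := by
  -- Layer cake: exp(-t) is the integral of exp(-s) over s ≥ t, to be exchanged with the integral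
  -- over x.
  have h1 : ∀ t : ℝ, ENNReal.ofReal (Real.exp (-t)) =
      ∫⁻ s, (Set.Ici t).indicator (fun s => ENNReal.ofReal (Real.exp (-s))) s := by
    intro t
    rw [lintegral_indicator measurableSet_Ici, setLIntegral_congr Ioi_ae_eq_Ici.symm,
      ← ofReal_integral_eq_lintegral_ofReal (integrableOn_exp_neg_Ioi t)
        (Filter.Eventually.of_forall fun _ => (Real.exp_pos _).le), integral_exp_neg_Ioi]
  have hpre : ∀ s : ℝ, 0 < s → volume {x | g x ≤ s} =
      ENNReal.ofReal (s ^ Fintype.card ι) * volume {x | g x ≤ 1} := by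
    intro s hs
    have h2 : {x | g x ≤ s} = (fun x => s⁻¹ • x) ⁻¹' {x | g x ≤ 1} := by
      ext x
      simp only [Set.mem_ofPred_eq, Set.mem_preimage]
      rw [hsmul _ (inv_nonneg.2 hs.le), inv_mul_le_iff₀ hs, mul_one]
    rw [h2, Measure.addHaar_preimage_smul _ (inv_ne_zero hs.ne'), Module.finrank_fintype_fun_eq_card,
      inv_pow, inv_inv, abs_of_pos (by positivity)]
  have h3 : ∀ s : ℝ, ∫⁻ x, (Set.Ici (g x)).indicator
      (fun s => ENNReal.ofReal (Real.exp (-s))) s =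
      ENNReal.ofReal (Real.exp (-s)) * volume {x | g x ≤ s} := by
    intro s
    rw [← lintegral_indicator_const (measurableSet_le hg measurable_const)]
    rfl
  have hmeas : Measurable (Function.uncurry fun (x : ι → ℝ) (s : ℝ) =>
      (Set.Ici (g x)).indicator (fun s => ENNReal.ofReal (Real.exp (-s))) s) := by
    have : (Function.uncurry fun (x : ι → ℝ) (s : ℝ) =>
        (Set.Ici (g x)).indicator (fun s => ENNReal.ofReal (Real.exp (-s))) s) =
        {p : (ι → ℝ) × ℝ | g p.1 ≤ p.2}.indicator fun p => ENNReal.ofReal (Real.exp (-p.2)) := by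
      ext ⟨x, s⟩; rfl
    rw [this]
    exact Measurable.indicator (by fun_prop)
      (measurableSet_le (hg.comp measurable_fst) measurable_snd)
  have h4 : ∀ s : ℝ, s ∉ Set.Ici (0 : ℝ) → {x | g x ≤ s} = ∅ := fun s hs =>
    Set.eq_empty_of_forall_notMem fun x hx => hs ((hg0 x).trans hx)
  calc ∫⁻ x, ENNReal.ofReal (Real.exp (-g x))
      = ∫⁻ s, ENNReal.ofReal (Real.exp (-s)) * volume {x | g x ≤ s} := by
        rw [lintegral_congr fun x => h1 (g x), lintegral_lintegral_swap hmeas.aemeasurable]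
        exact lintegral_congr h3
    _ = ∫⁻ s in Set.Ici (0 : ℝ), ENNReal.ofReal (Real.exp (-s)) * volume {x | g x ≤ s} := by
        rw [← lintegral_indicator measurableSet_Ici]
        congr 1 with s
        by_cases hs : s ∈ Set.Ici (0 : ℝ)
        · rw [Set.indicator_of_mem hs]
        · rw [Set.indicator_of_notMem hs, h4 s hs, measure_empty, mul_zero]
    -- The exponent has the form (n + 1) - 1 to match the Gamma integral.
    _ = ∫⁻ s in Set.Ioi (0 : ℝ),
          ENNReal.ofReal (Real.exp (-s) * s ^ (((Fintype.card ι : ℝ) + 1) - 1)) *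
            volume {x | g x ≤ 1} := by
        rw [setLIntegral_congr Ioi_ae_eq_Ici.symm]
        refine setLIntegral_congr_fun measurableSet_Ioi fun s hs => ?_
        rw [hpre s hs, ENNReal.ofReal_mul (Real.exp_pos _).le, add_sub_cancel_right,
          Real.rpow_natCast, mul_assoc]
    _ = ((Fintype.card ι).factorial : ENNReal) * volume {x | g x ≤ 1} := by
        have hpos : (0 : ℝ) < (Fintype.card ι : ℝ) + 1 := by positivity
        rw [lintegral_mul_const _ (by fun_prop), ← ofReal_integral_eq_lintegral_ofReal
            (Real.GammaIntegral_convergent hpos), ← Real.Gamma_eq_integral hpos,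
          Real.Gamma_nat_eq_factorial, ENNReal.ofReal_natCast]
        · refine (ae_restrict_iff' measurableSet_Ioi).2 (Filter.Eventually.of_forall fun s hs => ?_)
          have : (0 : ℝ) < s := hs
          positivity

/-- The exponential integral of a positive linear form over the positive orthant. -/
theorem setLIntegral_exp_neg_sum {w : ι → ℝ} (hw : ∀ k, 0 < w k) :
    ∫⁻ u in {u : ι → ℝ | ∀ k, 0 < u k}, ENNReal.ofReal (Real.exp (-∑ k, u k * w k)) =
      ENNReal.ofReal (1 / ∏ k, w k) := by
  have hmeas : MeasurableSet {u : ι → ℝ | ∀ k, 0 < u k} := by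
    rw [Set.ofPred_forall]
    exact MeasurableSet.iInter fun k => measurableSet_lt measurable_const (measurable_pi_apply k)
  set φ : ι → ℝ → ℝ := fun k => (Set.Ioi 0).indicator fun t => Real.exp (-w k * t) with hφ
  have hint : ∀ k, Integrable (φ k) := fun k =>
    (integrable_indicator_iff measurableSet_Ioi).2 (exp_neg_integrableOn_Ioi 0 (hw k))
  have hnn : ∀ k t, 0 ≤ φ k t := fun k t => Set.indicator_nonneg (fun _ _ => (Real.exp_pos _).le) t
  have h1 : ({u : ι → ℝ | ∀ k, 0 < u k}.indicator fun u =>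
      ENNReal.ofReal (Real.exp (-∑ k, u k * w k))) = fun u => ENNReal.ofReal (∏ k, φ k (u k)) := by
    ext u
    by_cases hu : ∀ k, 0 < u k
    · rw [Set.indicator_of_mem (by exact hu), ← Finset.sum_neg_distrib, Real.exp_sum]
      congr 1
      refine Finset.prod_congr rfl fun k _ => ?_
      rw [hφ]
      simp only
      rw [Set.indicator_of_mem (by exact hu k)]
      congr 1; ring
    · rw [Set.indicator_of_notMem (by exact hu)]
      push Not at hu
      obtain ⟨k, hk⟩ := hu
      rw [Finset.prod_eq_zero (Finset.mem_univ k), ENNReal.ofReal_zero]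
      exact Set.indicator_of_notMem (by simpa using hk) _
  have hprod : Integrable fun u : ι → ℝ => ∏ k, φ k (u k) := Integrable.fintype_prod hint
  rw [← lintegral_indicator hmeas, h1, ← ofReal_integral_eq_lintegral_ofReal hprod
    (Filter.Eventually.of_forall fun u => Finset.prod_nonneg fun k _ => hnn k _),
    integral_fintype_prod_volume_eq_prod, one_div, ← Finset.prod_inv_distrib]
  congr 1
  refine Finset.prod_congr rfl fun k _ => ?_
  rw [integral_indicator measurableSet_Ioi, integral_exp_mul_Ioi (neg_lt_zero.2 (hw k))]
  simp

end LayerCake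

/-! ### Decomposition into sectors of ordered coordinates -/

section Sectors

variable {E : Type*} [DecidableEq E]

/-- Extension of vectors on `E ∖ {i}` by zero at `i`, as a linear map. -/
def extendLin (R : Type*) [CommRing R] (i : E) : ({e : E // e ≠ i} → R) →ₗ[R] (E → R) where
  toFun z e := if h : e ≠ i then z ⟨e, h⟩ else 0
  map_add' z w := by ext e; by_cases h : e = i <;> simp [h]
  map_smul' c z := by ext e; by_cases h : e = i <;> simp [h]

theorem extendLin_of_ne (R : Type*) [CommRing R] {i e : E} (h : e ≠ i)
    (z : {e : E // e ≠ i} → R) : extendLin R i z e = z ⟨e, h⟩ := dif_pos h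

theorem extendLin_self (R : Type*) [CommRing R] (i : E) (z : {e : E // e ≠ i} → R) :
    extendLin R i z i = 0 := dif_neg (by simp)

theorem extendBy_zero (i : E) : extendBy 0 i = extendLin ℝ i := rfl

variable {n : ℕ}

/-- Successive differences along a total order of the extension of a vector by zero at `i`. -/
def sectorDiff (R : Type*) [CommRing R] (σ : Fin (n + 1) ≃ E) (i : E) :
    ({e : E // e ≠ i} → R) →ₗ[R] (Fin n → R) :=
  LinearMap.pi fun k => (LinearMap.proj (R := R) (φ := fun _ : E => R) (σ k.castSucc) -
    LinearMap.proj (σ k.succ)) ∘ₗ extendLin R i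

theorem sectorDiff_apply (R : Type*) [CommRing R] (σ : Fin (n + 1) ≃ E) (i : E)
    (z : {e : E // e ≠ i} → R) (k : Fin n) :
    sectorDiff R σ i z k = extendLin R i z (σ k.castSucc) - extendLin R i z (σ k.succ) := rfl

/-- The value 0 at i fixes the additive constant that differences leave free. General coefficients
matter: bijectivity over ℤ forces determinant ±1. -/
theorem sectorDiff_bijective (R : Type*) [CommRing R] (σ : Fin (n + 1) ≃ E) (i : E) :
    Function.Bijective (sectorDiff R σ i) := by
  constructor
  · rw [← LinearMap.ker_eq_bot, LinearMap.ker_eq_bot']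
    intro z hz
    have h1 : ∀ k, extendLin R i z (σ k) = extendLin R i z (σ 0) := by
      intro k
      induction k using Fin.induction with
      | zero => rfl
      | succ k ih =>
        rw [← ih]
        exact (sub_eq_zero.1 (congrFun hz k)).symm
    have h2 : ∀ e, extendLin R i z e = 0 := by
      intro e
      have h3 := h1 (σ.symm e)
      have h4 := h1 (σ.symm i)
      rw [Equiv.apply_symm_apply] at h3 h4
      rw [h3, ← h4, extendLin_self]
    ext ⟨e, he⟩
    rw [← extendLin_of_ne R he z, h2]
    rfl
  · intro u
    -- Tail sums of u have successive differences u; subtracting `w i` normalises them at i.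
    let w : E → R := fun e => ∑ j : Fin n with σ.symm e ≤ j.castSucc, u j
    refine ⟨fun e => w e - w i, ?_⟩
    have hw : ∀ e, extendLin R i (fun e : {e : E // e ≠ i} => w e - w i) e = w e - w i := by
      intro e
      by_cases h : e = i
      · subst h; rw [extendLin_self, sub_self]
      · rw [extendLin_of_ne R h]
    ext k
    rw [sectorDiff_apply, hw, hw, sub_sub_sub_cancel_right]
    have h3 : (Finset.univ.filter fun j : Fin n => k.castSucc ≤ j.castSucc) =
        insert k (Finset.univ.filter fun j : Fin n => k.succ ≤ j.castSucc) := by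
      ext j
      simp only [Finset.mem_filter, Finset.mem_univ, true_and, Finset.mem_insert, Fin.le_def,
        Fin.val_castSucc, Fin.val_succ, Fin.ext_iff]
      omega
    simp only [w, Equiv.symm_apply_apply]
    rw [h3, Finset.sum_insert (by simp), add_sub_cancel_right]

variable [Fintype E]

/-- The passage to successive differences is unimodular. -/
theorem measurePreserving_sectorDiff (σ : Fin (n + 1) ≃ E) (i : E) :
    MeasurePreserving (sectorDiff ℝ σ i) := by
  have hcard : Fintype.card (Fin n) = Fintype.card {e : E // e ≠ i} := by
    have := Fintype.card_congr σ
    rw [Fintype.card_fin] at this ⊢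
    rw [Fintype.card_subtype_compl, Fintype.card_subtype_eq, ← this, Nat.add_sub_cancel]
  let p : Fin n ≃ {e : E // e ≠ i} := Fintype.equivOfCardEq hcard
  -- Relabelling the coordinates makes the map an endomorphism, so that its determinant over ℝ can
  -- be compared with that over ℤ.
  let D : ∀ (R : Type) [CommRing R], (Fin n → R) →ₗ[R] (Fin n → R) := fun R _ =>
    sectorDiff R σ i ∘ₗ (LinearEquiv.funCongrLeft R R p.symm).toLinearMap
  have hbij : Function.Bijective (D ℤ) :=
    (sectorDiff_bijective ℤ σ i).comp (LinearEquiv.funCongrLeft ℤ ℤ p.symm).bijective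
  have hcast : ∀ (w : Fin n → ℤ) (k : Fin n), D ℝ (fun j => (w j : ℝ)) k = (D ℤ w k : ℝ) := by
    have hext : ∀ (z : {e : E // e ≠ i} → ℤ) (e : E),
        extendLin ℝ i (fun e => (z e : ℝ)) e = (extendLin ℤ i z e : ℝ) := by
      intro z e
      by_cases h : e = i
      · subst h; simp [extendLin_self]
      · rw [extendLin_of_ne _ h, extendLin_of_ne _ h]
    intro w k
    simp only [D, LinearMap.comp_apply, sectorDiff_apply]
    push_cast
    rw [← hext, ← hext]
    rfl
  have hdet : LinearMap.det (D ℝ) = ((LinearMap.det (D ℤ) : ℤ) : ℝ) := by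
    rw [← LinearMap.det_toMatrix', ← LinearMap.det_toMatrix', Int.cast_det]
    congr 1
    ext k j
    rw [Matrix.map_apply, LinearMap.toMatrix'_apply, LinearMap.toMatrix'_apply, ← hcast]
    refine congrFun (congrArg _ (funext fun j' => ?_)) k
    simp [Pi.single_apply]
  have hunit : |LinearMap.det (D ℝ)| = 1 := by
    have h := LinearEquiv.isUnit_det' (LinearEquiv.ofBijective (D ℤ) hbij)
    have h' : IsUnit (LinearMap.det (D ℤ)) := h
    rw [hdet]
    exact_mod_cast Int.isUnit_iff_abs_eq.1 h'
  have hD : MeasurePreserving (D ℝ) := by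
    refine ⟨(D ℝ).continuous_of_finiteDimensional.measurable, ?_⟩
    rw [Measure.map_linearMap_addHaar_eq_smul_addHaar _ (by
      intro h; rw [h, abs_zero] at hunit; exact zero_ne_one hunit), abs_inv, hunit]
    simp
  have hp := (volume_measurePreserving_piCongrLeft (fun _ : {e : E // e ≠ i} => ℝ) p).symm
  have heq : (sectorDiff ℝ σ i : ({e : E // e ≠ i} → ℝ) → (Fin n → ℝ)) =
      D ℝ ∘ (MeasurableEquiv.piCongrLeft (fun _ : {e : E // e ≠ i} => ℝ) p).symm := by
    ext z k
    simp only [D, Function.comp_apply, LinearMap.comp_apply]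
    refine congrFun (congrArg _ (funext fun e => ?_)) k
    exact (congrArg z (p.apply_symm_apply e)).symm
  rw [heq]
  exact hD.comp hp

/-- The open sector of vectors whose extension by zero is strictly decreasing along `σ`. -/
def sector (σ : Fin (n + 1) ≃ E) (i : E) : Set ({e : E // e ≠ i} → ℝ) :=
  {z | StrictAnti (extendBy 0 i z ∘ σ)}

omit [Fintype E] in
theorem sector_eq_preimage (σ : Fin (n + 1) ≃ E) (i : E) :
    sector σ i = sectorDiff ℝ σ i ⁻¹' {u | ∀ k, 0 < u k} := by
  ext z
  simp only [sector, Set.mem_ofPred_eq, Set.mem_preimage, Fin.strictAnti_iff_succ_lt,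
    sectorDiff_apply, sub_pos]
  rfl

theorem measurableSet_sector (σ : Fin (n + 1) ≃ E) (i : E) : MeasurableSet (sector σ i) := by
  rw [sector_eq_preimage]
  refine (measurePreserving_sectorDiff σ i).measurable ?_
  rw [Set.ofPred_forall]
  exact MeasurableSet.iInter fun k => measurableSet_lt measurable_const (measurable_pi_apply k)

omit [Fintype E] in
theorem pairwise_disjoint_sector (i : E) :
    Pairwise (Function.onFun Disjoint fun σ : Fin (n + 1) ≃ E => sector σ i) := by
  intro σ τ hne
  refine Set.disjoint_left.2 fun z hσ hτ => hne ?_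
  -- Both orders enumerate the same set of values decreasingly, so the enumerations agree.
  have h := (StrictMono.range_inj (StrictAnti.dual_right hσ) (StrictAnti.dual_right hτ)).1 (by
    simp only [Set.range_comp, EquivLike.range_eq_univ])
  have hinj : Function.Injective (extendBy 0 i z) := by
    have := (StrictAnti.injective hσ).comp σ.symm.injective
    simpa [Function.comp_assoc] using this
  exact Equiv.ext fun k => hinj (OrderDual.toDual.injective (congrFun h k))

/-- Each tie y_e = y_e' with e ≠ e' defines a proper linear subspace, which is null, and there are
finitely many. -/
theorem ae_injective_extendBy (i : E) :
    ∀ᵐ z : {e : E // e ≠ i} → ℝ, Function.Injective (extendBy 0 i z) := by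
  have key : ∀ e e' : E, e ≠ e' → ∀ᵐ z : {e : E // e ≠ i} → ℝ,
      extendBy 0 i z e ≠ extendBy 0 i z e' := by
    intro e e' hne
    let S : Submodule ℝ ({e : E // e ≠ i} → ℝ) :=
      LinearMap.ker ((LinearMap.proj (R := ℝ) (φ := fun _ : E => ℝ) e - LinearMap.proj e') ∘ₗ
        extendLin ℝ i)
    have hS : S ≠ ⊤ := by
      intro h
      have hall : ∀ z, extendLin ℝ i z e = extendLin ℝ i z e' := fun z => by
        have : z ∈ S := h ▸ Submodule.mem_top
        exact sub_eq_zero.1 this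
      by_cases hi : e = i
      · have h1 := hall fun _ => 1
        rw [hi, extendLin_self, extendLin_of_ne ℝ (hi ▸ hne.symm)] at h1
        exact zero_ne_one h1
      · have h1 := hall (Pi.single ⟨e, hi⟩ 1)
        rw [extendLin_of_ne ℝ hi, Pi.single_eq_same] at h1
        by_cases hi' : e' = i
        · rw [hi', extendLin_self] at h1
          exact one_ne_zero h1
        · rw [extendLin_of_ne ℝ hi', Pi.single_eq_of_ne (by simpa using hne.symm)] at h1
          exact one_ne_zero h1
    have h0 := Measure.addHaar_submodule volume S hS
    filter_upwards [measure_eq_zero_iff_ae_notMem.1 h0] with z hz heq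
    exact hz (sub_eq_zero.2 heq)
  have hall : ∀ᵐ z : {e : E // e ≠ i} → ℝ, ∀ e e' : E, e ≠ e' →
      extendBy 0 i z e ≠ extendBy 0 i z e' := by
    simp only [ae_all_iff]
    exact key
  filter_upwards [hall] with z hz e e' h
  by_contra hne
  exact hz e e' hne h

/-- Integrals decompose into integrals over sectors. -/
theorem lintegral_eq_sum_sector (hn : Fintype.card E = n + 1) (i : E)
    (F : ({e : E // e ≠ i} → ℝ) → ENNReal) :
    ∫⁻ z, F z = ∑ σ : Fin (n + 1) ≃ E, ∫⁻ z in sector σ i, F z := by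
  rw [← tsum_fintype (L := .unconditional _), ← lintegral_iUnion (fun σ => measurableSet_sector σ i)
    (pairwise_disjoint_sector i), ← setLIntegral_univ]
  refine setLIntegral_congr ?_
  symm
  rw [ae_eq_univ, ← mem_ae_iff]
  filter_upwards [ae_injective_extendBy i] with z hz
  obtain ⟨σ, hσ⟩ := exists_antitone_order hn (extendBy 0 i z)
  exact Set.mem_iUnion.2 ⟨σ, hσ.strictAnti_of_injective (hz.comp σ.injective)⟩

end Sectors

/-! ### The Hepp bound as an exponential integral and as a volume -/

section HeppBound

variable {E : Type*} [Fintype E] [DecidableEq E]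

theorem heppBound_eq_sum_prefixSet (ℓ : Finset E → ℤ) (d : ℝ) (a : E → ℝ) {n : ℕ}
    (hn : Fintype.card E = n + 1) :
    heppBound ℓ d a = ∑ σ : Fin (n + 1) ≃ E, 1 / ∏ k : Fin n, sdc ℓ d a (prefixSet σ (k + 1)) := by
  -- A variable in place of `Fintype.card E` allows substitution in the type `Fin m ≃ E`.
  have h : ∀ m, m = n + 1 → ∑ σ : Fin m ≃ E, 1 / ∏ k ∈ Finset.Ico 1 m, sdc ℓ d a (prefixSet σ k) =
      ∑ σ : Fin (n + 1) ≃ E, 1 / ∏ k : Fin n, sdc ℓ d a (prefixSet σ (k + 1)) := by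
    rintro _ rfl
    refine Finset.sum_congr rfl fun σ _ => ?_
    rw [Finset.prod_Ico_eq_prod_range, Finset.prod_range]
    simp only [add_comm 1]
    rfl
  exact h _ hn

variable {r : Finset E → ℤ} {ℓ : Finset E → ℤ} {d : ℝ} {a : E → ℝ}

theorem measurable_supportFn_extendBy (B : Set (Finset E)) (d : ℝ) (a : E → ℝ) (i : E) :
    Measurable fun z => supportFn B d a (extendBy 0 i z) := by
  refine Measurable.iSup fun T => Finset.measurable_sum _ fun e _ => Measurable.mul_const ?_ _
  exact (measurable_pi_apply e).comp
    (extendLin ℝ i).continuous_of_finiteDimensional.measurable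

/-- In the coordinates u_k the sector is the positive orthant and the support function is linear
with coefficients ω, so the integral factorises. -/
theorem setLIntegral_sector (hr : IsRankFunction r) (hℓ : ∀ γ, ℓ γ = γ.card - r γ) (hd : 0 ≤ d)
    (h : IsPLog ℓ d a) {n : ℕ} (σ : Fin (n + 1) ≃ E) (i : E) :
    ∫⁻ z in sector σ i, ENNReal.ofReal (Real.exp (-supportFn (rankBases r) d a (extendBy 0 i z))) =
      ENNReal.ofReal (1 / ∏ k : Fin n, sdc ℓ d a (prefixSet σ (k + 1))) := by
  have hω : ∀ k : Fin n, 0 < sdc ℓ d a (prefixSet σ (k + 1)) := fun k =>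
    h.2 _ (prefixSet_succ_nonempty_ne_univ σ k).1 (prefixSet_succ_nonempty_ne_univ σ k).2
  rw [← setLIntegral_exp_neg_sum hω]
  have hmeas : MeasurableSet {u : Fin n → ℝ | ∀ k, 0 < u k} := by
    rw [Set.ofPred_forall]
    exact MeasurableSet.iInter fun k => measurableSet_lt measurable_const (measurable_pi_apply k)
  rw [← (measurePreserving_sectorDiff σ i).setLIntegral_comp_preimage hmeas (by fun_prop),
    ← sector_eq_preimage]
  refine setLIntegral_congr_fun (measurableSet_sector σ i) fun z hz => ?_
  rw [supportFn_eq_sum hr hℓ hd h.1 σ _ (StrictAnti.antitone hz)]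
  rfl

omit [DecidableEq E] in
theorem one_div_prod_sdc_nonneg (h : IsPLog ℓ d a) {n : ℕ} (σ : Fin (n + 1) ≃ E) :
    0 ≤ 1 / ∏ k : Fin n, sdc ℓ d a (prefixSet σ (k + 1)) :=
  one_div_nonneg.2 (Finset.prod_nonneg fun k _ => (h.2 _ (prefixSet_succ_nonempty_ne_univ σ k).1
    (prefixSet_succ_nonempty_ne_univ σ k).2).le)

theorem heppBound_nonneg (h : IsPLog ℓ d a) (i : E) : 0 ≤ heppBound ℓ d a := by
  obtain ⟨n, hn⟩ := exists_card_eq_succ i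
  rw [heppBound_eq_sum_prefixSet ℓ d a hn]
  exact Finset.sum_nonneg fun σ _ => one_div_prod_sdc_nonneg h σ

theorem lintegral_exp_neg_supportFn (hr : IsRankFunction r) (hℓ : ∀ γ, ℓ γ = γ.card - r γ)
    (hd : 0 ≤ d) (h : IsPLog ℓ d a) (i : E) :
    ∫⁻ z, ENNReal.ofReal (Real.exp (-supportFn (rankBases r) d a (extendBy 0 i z))) =
      ENNReal.ofReal (heppBound ℓ d a) := by
  obtain ⟨n, hn⟩ := exists_card_eq_succ i
  rw [lintegral_eq_sum_sector hn i, heppBound_eq_sum_prefixSet ℓ d a hn,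
    ENNReal.ofReal_sum_of_nonneg fun σ _ => one_div_prod_sdc_nonneg h σ]
  exact Finset.sum_congr rfl fun σ _ => setLIntegral_sector hr hℓ hd h σ i

theorem supportFn_nonneg (hr : IsRankFunction r) (hℓ : ∀ γ, ℓ γ = γ.card - r γ)
    (hd : 0 ≤ d) (h : IsPLog ℓ d a) (i : E) (y : E → ℝ) :
    0 ≤ supportFn (rankBases r) d a y := by
  obtain ⟨n, hn⟩ := exists_card_eq_succ i
  obtain ⟨σ, hσ⟩ := exists_antitone_order hn y
  rw [supportFn_eq_sum hr hℓ hd h.1 σ y hσ]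
  exact Finset.sum_nonneg fun k _ => mul_nonneg (sub_nonneg.2 (hσ (Fin.castSucc_le_succ k)))
    (h.2 _ (prefixSet_succ_nonempty_ne_univ σ k).1 (prefixSet_succ_nonempty_ne_univ σ k).2).le

theorem heppBound_eq_factorial_mul_sliceVolume (hr : IsRankFunction r)
    (hℓ : ∀ γ, ℓ γ = γ.card - r γ) (hd : 0 ≤ d) (h : IsPLog ℓ d a) (i : E) :
    heppBound ℓ d a =
      ((Fintype.card E - 1).factorial : ℝ) * sliceVolume (polar (rankBases r) d a) i := by
  have h1 := lintegral_exp_neg_eq_factorial_mul_volume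
    (measurable_supportFn_extendBy (rankBases r) d a i)
    (fun z => supportFn_nonneg hr hℓ hd h i _) (fun c hc z => by
      rw [extendBy_zero, map_smul, supportFn_smul _ _ _ _ hc])
  have hslice : {z | supportFn (rankBases r) d a (extendBy 0 i z) ≤ 1} =
      slice (polar (rankBases r) d a) i := by
    ext z
    exact (mem_polar_iff_supportFn hr.rankBases_nonempty d a _).symm
  have hcard : Fintype.card {e : E // e ≠ i} = Fintype.card E - 1 := by
    rw [Fintype.card_subtype_compl, Fintype.card_subtype_eq]
  rw [lintegral_exp_neg_supportFn hr hℓ hd h, hslice, hcard] at h1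
  have h2 := congrArg ENNReal.toReal h1
  rwa [ENNReal.toReal_ofReal (heppBound_nonneg h i), ENNReal.toReal_mul,
    ENNReal.toReal_natCast] at h2

end HeppBound

/-! ### The Hepp integral in logarithmic coordinates -/

section Mellin

variable {E : Type*} [Fintype E] [DecidableEq E] {B : Set (Finset E)} {d : ℝ}

theorem sum_mul_newtonVertex (d : ℝ) (a y : E → ℝ) (T : Finset E) :
    ∑ e, y e * newtonVertex d a T e = ∑ e, y e * a e - d / 2 * ∑ e ∈ Tᶜ, y e := by
  simp only [newtonVertex, mul_sub, Finset.sum_sub_distrib]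
  congr 1
  rw [Finset.mul_sum, ← Finset.sum_filter_add_sum_filter_not Finset.univ (· ∈ T)]
  rw [Finset.sum_eq_zero (fun e he => by simp [(Finset.mem_filter.1 he).2]), zero_add]
  refine Finset.sum_congr (by ext; simp) fun e he => ?_
  rw [if_neg (by simpa using he)]
  ring

/-- In logarithmic coordinates, the tropical polynomial is the exponential of the support
function, up to a linear form. -/
theorem tropPoly_exp_rpow (hB : B.Nonempty) (hd : 0 ≤ d) (a y : E → ℝ) :
    tropPoly B (fun e => Real.exp (-y e)) ^ (d / 2) =
      Real.exp (supportFn B d a y - ∑ e, y e * a e) := by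
  have := hB.to_subtype
  -- A set attaining the tropical maximum also attains the support function, since exp is increasing
  -- and d ≥ 0.
  obtain ⟨T, hT⟩ := exists_eq_ciSup_of_finite
    (f := fun T : B => ∏ e ∈ (T : Finset E)ᶜ, Real.exp (-y e))
  have hle : ∀ T' : B, ∑ e ∈ (T : Finset E)ᶜ, y e ≤ ∑ e ∈ (T' : Finset E)ᶜ, y e := by
    intro T'
    have h1 := le_ciSup (f := fun T : B => ∏ e ∈ (T : Finset E)ᶜ, Real.exp (-y e))
      (Set.finite_range _).bddAbove T'
    rw [← hT] at h1
    simp only [← Real.exp_sum, Real.exp_le_exp, Finset.sum_neg_distrib, neg_le_neg_iff] at h1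
    exact h1
  have hsup : supportFn B d a y = ∑ e, y e * newtonVertex d a T e := by
    refine le_antisymm ((supportFn_le_iff hB d a y _).2 fun T' hT' => ?_) (le_supportFn d a y T.2)
    rw [sum_mul_newtonVertex, sum_mul_newtonVertex]
    have := hle ⟨T', hT'⟩
    gcongr
  rw [tropPoly, ← hT, hsup, sum_mul_newtonVertex, ← Real.exp_sum, ← Real.exp_mul,
    Finset.sum_neg_distrib]
  congr 1
  ring

omit [Fintype E] in
theorem extendBy_one_exp (i : E) (t : {e : E // e ≠ i} → ℝ) :
    extendBy 1 i (fun e => Real.exp (-t e)) = fun e => Real.exp (-extendBy 0 i t e) := by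
  ext e
  by_cases h : e = i <;> simp [extendBy, h]

/-- The first product is the Jacobian, which removes the -1 from the exponents a_e - 1; the
resulting linear form cancels against the one in `tropPoly_exp_rpow`. -/
theorem exp_mul_mellinIntegrand (hB : B.Nonempty) (hd : 0 ≤ d) (a : E → ℝ) (i : E)
    (t : {e : E // e ≠ i} → ℝ) :
    (∏ e, Real.exp (-t e)) * mellinIntegrand B d a i (fun e => Real.exp (-t e)) =
      Real.exp (-supportFn B d a (extendBy 0 i t)) := by
  rw [mellinIntegrand, extendBy_one_exp, tropPoly_exp_rpow hB hd a, ← mul_div_assoc,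
    ← Finset.prod_mul_distrib]
  have h1 : ∏ e, Real.exp (-t e) * Real.exp (-t e) ^ (a e - 1) =
      Real.exp (-∑ e, extendBy 0 i t e * a e) := by
    have h2 : ∑ e, extendBy 0 i t e * a e = ∑ e : {e : E // e ≠ i}, t e * a e := by
      rw [← Finset.sum_erase (a := i) Finset.univ (by simp [extendBy]),
        Finset.sum_subtype (p := fun e => e ≠ i) _ (by simp)]
      exact Finset.sum_congr rfl fun e _ => by simp [extendBy, e.2]
    rw [h2, ← Finset.sum_neg_distrib, Real.exp_sum]
    refine Finset.prod_congr rfl fun e _ => ?_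
    rw [← Real.exp_mul, ← Real.exp_add]
    congr 1
    ring
  rw [h1, ← Real.exp_sub]
  congr 1
  ring

omit [Fintype E] [DecidableEq E] in
theorem image_exp_neg (i : E) :
    (fun (t : {e : E // e ≠ i} → ℝ) e => Real.exp (-t e)) '' Set.univ = positiveOrthant i := by
  ext z
  constructor
  · rintro ⟨t, -, rfl⟩ e
    exact Real.exp_pos _
  · intro hz
    refine ⟨fun e => -Real.log (z e), trivial, funext fun e => ?_⟩
    simp only
    rw [neg_neg, Real.exp_log (hz e)]

/-- The derivative of the coordinatewise map `t ↦ exp (-t)`. -/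
def expNegDeriv {ι : Type*} [Fintype ι] (t : ι → ℝ) : (ι → ℝ) →L[ℝ] (ι → ℝ) :=
  ContinuousLinearMap.pi fun e =>
    (-Real.exp (-t e) • ContinuousLinearMap.id ℝ ℝ).comp (ContinuousLinearMap.proj e)

theorem hasFDerivAt_exp_neg {ι : Type*} [Fintype ι] (t : ι → ℝ) :
    HasFDerivAt (fun (t : ι → ℝ) e => Real.exp (-t e)) (expNegDeriv t) t := by
  rw [expNegDeriv, hasFDerivAt_pi]
  intro e
  have h := (Real.hasDerivAt_exp (-t e)).comp_hasFDerivAt t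
    (ContinuousLinearMap.proj (R := ℝ) (φ := fun _ : ι => ℝ) e).hasFDerivAt.neg
  refine h.congr_fderiv ?_
  ext v
  simp

theorem abs_det_expNegDeriv {ι : Type*} [Fintype ι] (t : ι → ℝ) :
    |(expNegDeriv t).det| = ∏ e, Real.exp (-t e) := by
  rw [expNegDeriv, ContinuousLinearMap.det_pi, Finset.abs_prod]
  refine Finset.prod_congr rfl fun e _ => ?_
  have : (-Real.exp (-t e) • ContinuousLinearMap.id ℝ ℝ).det = -Real.exp (-t e) := by
    simp [ContinuousLinearMap.det]
  rw [this, abs_neg, Real.abs_exp]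

theorem injective_exp_neg {ι : Type*} :
    Function.Injective fun (t : ι → ℝ) e => Real.exp (-t e) := fun _ _ h =>
  funext fun e => neg_injective (Real.exp_injective (congrFun h e))

theorem integrableOn_mellinIntegrand_iff (hB : B.Nonempty) (hd : 0 ≤ d) (a : E → ℝ) (i : E) :
    IntegrableOn (mellinIntegrand B d a i) (positiveOrthant i) ↔
      Integrable fun t => Real.exp (-supportFn B d a (extendBy 0 i t)) := by
  rw [← image_exp_neg, integrableOn_image_iff_integrableOn_abs_det_fderiv_smul volume
    MeasurableSet.univ (fun t _ => (hasFDerivAt_exp_neg t).hasFDerivWithinAt)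
    injective_exp_neg.injOn, integrableOn_univ]
  simp only [abs_det_expNegDeriv, smul_eq_mul, exp_mul_mellinIntegrand hB hd]

theorem heppIntegral_eq_integral_exp (hB : B.Nonempty) (hd : 0 ≤ d) (a : E → ℝ) (i : E) :
    heppIntegral B d a i = ∫ t, Real.exp (-supportFn B d a (extendBy 0 i t)) := by
  rw [heppIntegral, ← image_exp_neg, integral_image_eq_integral_abs_det_fderiv_smul volume
    MeasurableSet.univ (fun t _ => (hasFDerivAt_exp_neg t).hasFDerivWithinAt)
    injective_exp_neg.injOn, setIntegral_univ]
  simp only [abs_det_expNegDeriv, smul_eq_mul, exp_mul_mellinIntegrand hB hd]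

variable {r : Finset E → ℤ} {ℓ : Finset E → ℤ} {a : E → ℝ}

/-- Absolute convergence needs its own proof: a Bochner integral takes the value 0 when it diverges.
-/
theorem integrableOn_mellinIntegrand (hr : IsRankFunction r) (hℓ : ∀ γ, ℓ γ = γ.card - r γ)
    (hd : 0 ≤ d) (h : IsPLog ℓ d a) (i : E) :
    IntegrableOn (mellinIntegrand (rankBases r) d a i) (positiveOrthant i) := by
  rw [integrableOn_mellinIntegrand_iff hr.rankBases_nonempty hd]
  refine ⟨(measurable_supportFn_extendBy _ d a i).neg.exp.aestronglyMeasurable, ?_⟩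
  rw [hasFiniteIntegral_iff_ofReal (Filter.Eventually.of_forall fun _ => (Real.exp_pos _).le),
    lintegral_exp_neg_supportFn hr hℓ hd h]
  exact ENNReal.ofReal_lt_top

theorem heppIntegral_eq_heppBound (hr : IsRankFunction r) (hℓ : ∀ γ, ℓ γ = γ.card - r γ)
    (hd : 0 ≤ d) (h : IsPLog ℓ d a) (i : E) :
    heppIntegral (rankBases r) d a i = heppBound ℓ d a := by
  rw [heppIntegral_eq_integral_exp hr.rankBases_nonempty hd, integral_eq_lintegral_of_nonneg_ae
    (f := fun t => Real.exp (-supportFn (rankBases r) d a (extendBy 0 i t)))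
    (Filter.Eventually.of_forall fun _ => (Real.exp_pos _).le)
    (Real.measurable_exp.comp (measurable_supportFn_extendBy _ d a i).neg).aestronglyMeasurable,
    lintegral_exp_neg_supportFn hr hℓ hd h, ENNReal.toReal_ofReal (heppBound_nonneg h i)]

end Mellin

/-! ### Matroids and graphs as rank functions -/

section Instances

theorem isRankFunction_eRk {E : Type*} [Fintype E] [DecidableEq E] (M : Matroid E) :
    IsRankFunction fun γ : Finset E => ((M.eRk γ).toNat : ℤ) := by
  have hfin : ∀ γ : Finset E, M.eRk γ ≠ ⊤ := fun γ =>
    ne_top_of_le_ne_top (by simp) (M.eRk_le_encard γ)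
  have hlift : ∀ γ : Finset E, M.eRk γ = ((M.eRk γ).toNat : ℕ∞) := fun γ =>
    (ENat.natCast_toNat (hfin γ)).symm
  have hmono : ∀ A C : Finset E, A ⊆ C → (M.eRk A).toNat ≤ (M.eRk C).toNat := fun A C h =>
    ENat.toNat_le_toNat (M.eRk_mono (Finset.coe_subset.2 h)) (hfin C)
  refine ⟨by simp, fun e γ => ?_, fun e γ => ?_, fun e I J hIJ h => ?_⟩
  · exact_mod_cast hmono _ _ (Finset.subset_insert e γ)
  · have h := M.eRk_insert_le_add_one e γ
    rw [← Finset.coe_insert, hlift (insert e γ), hlift γ] at h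
    exact_mod_cast h
  -- Submodularity for insert e I and J: the union is insert e J, and the intersection contains I,
  -- so its rank is at least that of insert e I.
  · have h1 := M.eRk_inter_add_eRk_union_le (insert e I : Finset E) J
    rw [← Finset.coe_inter, ← Finset.coe_union, Finset.insert_union, Finset.union_eq_right.2 hIJ,
      hlift (insert e I ∩ J), hlift (insert e J), hlift (insert e I), hlift J] at h1
    have h2 : (M.eRk (insert e I ∩ J : Finset E)).toNat + (M.eRk (insert e J : Finset E)).toNat ≤
        (M.eRk (insert e I : Finset E)).toNat + (M.eRk J).toNat := by exact_mod_cast h1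
    have h3 := hmono I (insert e I ∩ J) (Finset.subset_inter (Finset.subset_insert e I) hIJ)
    have h4 := hmono J (insert e J) (Finset.subset_insert e J)
    omega

theorem bases_eq_rankBases {E : Type*} [Fintype E] [DecidableEq E] (M : Matroid E)
    (hM : M.E = Set.univ) :
    bases M = rankBases fun γ : Finset E => ((M.eRk γ).toNat : ℤ) := by
  have huniv : M.eRk (Finset.univ : Finset E) = M.eRank := by
    rw [Finset.coe_univ, ← hM, M.eRk_ground]
  have hfin : ∀ γ : Finset E, M.eRk γ ≠ ⊤ := fun γ =>
    ne_top_of_le_ne_top (by simp) (M.eRk_le_encard γ)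
  ext T
  simp only [bases, rankBases, Set.mem_ofPred_eq, huniv, Nat.cast_inj]
  constructor
  · intro hT
    rw [hT.eRk_eq_eRank, ← hT.encard_eq_eRank]
    simp
  · rintro ⟨h1, h2⟩
    have h3 : M.eRk T = (T : Set E).encard := by
      rw [← ENat.natCast_toNat (hfin T), h1, Set.encard_coe_eq_coe_finsetCard]
    refine ((Matroid.indep_iff_eRk_eq_encard_of_finite T.finite_toSet).2 h3).isBase_of_eRk_ge
      T.finite_toSet ?_
    rw [← huniv, ← ENat.natCast_toNat (hfin T), h2, huniv, ENat.natCast_toNat (huniv ▸ hfin _)]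

section Graph

variable {V E : Type*} {G : Graph V E}

/-- The vertices of `G` up to connection by edges in `γ`. -/
abbrev Components (G : Graph V E) (γ : Finset E) : Type _ :=
  Quot fun x y : G.vertexSet => ∃ e ∈ γ, G.IsLink e x y

variable [DecidableEq E]

/-- Adding an edge induces a map between the sets of connected components. -/
def Components.insertMap (e : E) (γ : Finset E) : Components G γ → Components G (insert e γ) :=
  Quot.lift (Quot.mk _) fun _ _ ⟨f, hf, h⟩ => Quot.sound ⟨f, Finset.mem_insert_of_mem hf, h⟩

theorem Components.insertMap_surjective (e : E) (γ : Finset E) :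
    Function.Surjective (Components.insertMap (G := G) e γ) := by
  rintro ⟨x⟩
  exact ⟨Quot.mk _ x, rfl⟩

open Classical in
/-- Away from the component of one end of an added edge, the map between the sets of connected
components has a left inverse. -/
theorem Components.exists_leftInverse_insertMap {e : E} (γ : Finset E) {x y : G.vertexSet}
    (he : G.IsLink e x y) : ∃ g : Components G (insert e γ) → Components G γ,
      ∀ q : Components G γ, q ≠ Quot.mk _ x ∨ (Quot.mk _ x : Components G γ) = Quot.mk _ y →
        g (Components.insertMap e γ q) = q := by
  -- Redirecting the component of x to that of y makes the map constant across the new edge.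
  let g₀ : G.vertexSet → Components G γ := fun v =>
    if (Quot.mk _ v : Components G γ) = Quot.mk _ x then Quot.mk _ y else Quot.mk _ v
  have hxy : g₀ x = g₀ y := by
    simp [g₀]
  refine ⟨Quot.lift g₀ ?_, ?_⟩
  · rintro u v ⟨f, hf, h⟩
    rcases Finset.mem_insert.1 hf with rfl | hf
    · rcases he.eq_and_eq_or_eq_and_eq h with ⟨h1, h2⟩ | ⟨h1, h2⟩
      · rw [← Subtype.ext h1, ← Subtype.ext h2, hxy]
      · rw [← Subtype.ext h1, ← Subtype.ext h2, hxy]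
    · have : (Quot.mk _ u : Components G γ) = Quot.mk _ v := Quot.sound ⟨f, hf, h⟩
      simp only [g₀, this]
  · rintro ⟨v⟩ hv
    change g₀ v = Quot.mk _ v
    simp only [g₀]
    split_ifs with h
    · rcases hv with hv | hv
      · exact absurd h hv
      · rw [h, hv]
    · rfl

variable [Finite G.vertexSet]

theorem numComponents_insert_le (e : E) (γ : Finset E) :
    numComponents G (insert e γ) ≤ numComponents G γ :=
  Nat.card_le_card_of_surjective _ (Components.insertMap_surjective e γ)

theorem numComponents_le_insert_add_one {e : E} (γ : Finset E) {x y : G.vertexSet}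
    (he : G.IsLink e x y) : numComponents G γ ≤ numComponents G (insert e γ) + 1 := by
  classical
  obtain ⟨g, hg⟩ := Components.exists_leftInverse_insertMap γ he
  -- Only the component of x can be lost in a merger; `none` gives it a separate image.
  let φ : Components G γ → Option (Components G (insert e γ)) := fun q =>
    if q = Quot.mk _ x then none else some (Components.insertMap e γ q)
  have hφ : Function.Injective φ := by
    intro q q' h
    by_cases hq : q = Quot.mk _ x <;> by_cases hq' : q' = Quot.mk _ x <;> simp [φ, hq, hq'] at h
    · rw [hq, hq']
    · rw [← hg q (Or.inl hq), ← hg q' (Or.inl hq'), h]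
  exact (Nat.card_le_card_of_injective φ hφ).trans_eq Finite.card_option

theorem numComponents_insert_eq_iff {e : E} (γ : Finset E) {x y : G.vertexSet}
    (he : G.IsLink e x y) : numComponents G (insert e γ) = numComponents G γ ↔
      (Quot.mk _ x : Components G γ) = Quot.mk _ y := by
  have hxy : (Quot.mk _ x : Components G (insert e γ)) = Quot.mk _ y :=
    Quot.sound ⟨e, Finset.mem_insert_self e γ, he⟩
  constructor
  · intro h
    have hb := (Nat.bijective_iff_surjective_and_card (Components.insertMap (G := G) e γ)).2
      ⟨Components.insertMap_surjective e γ, h.symm⟩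
    exact hb.1 hxy
  · intro h
    obtain ⟨g, hg⟩ := Components.exists_leftInverse_insertMap γ he
    refine le_antisymm (numComponents_insert_le e γ)
      (Nat.card_le_card_of_injective (Components.insertMap (G := G) e γ) ?_)
    exact Function.LeftInverse.injective fun q => hg q (Or.inr h)

end Graph

/-- |V| - c(γ) is the rank in the cycle matroid. An edge leaves it unchanged exactly when its ends
are already connected, and they stay connected in any larger edge set. -/
theorem isRankFunction_graph {V E : Type*} [DecidableEq E] (G : Graph V E)
    (hV : G.vertexSet.Finite) (hE : G.edgeSet = Set.univ) :
    IsRankFunction fun γ : Finset E => (Nat.card G.vertexSet : ℤ) - numComponents G γ := by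
  have := hV.to_subtype
  have hlink : ∀ e, ∃ x y : G.vertexSet, G.IsLink e x y := fun e => by
    obtain ⟨x, y, h⟩ := G.exists_isLink_of_mem_edgeSet (hE ▸ Set.mem_univ e : e ∈ G.edgeSet)
    exact ⟨⟨x, h.left_mem⟩, ⟨y, h.right_mem⟩, h⟩
  refine ⟨?_, fun e γ => ?_, fun e γ => ?_, fun e I J hIJ h => ?_⟩
  · have h : Function.Bijective (Quot.mk _ : G.vertexSet → Components G ∅) := by
      refine ⟨fun x y h => ?_, Quot.mk_surjective⟩
      exact congrArg (Quot.lift id (by simp)) h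
    rw [sub_eq_zero]
    exact_mod_cast Nat.card_eq_of_bijective _ h
  · have := numComponents_insert_le (G := G) e γ
    omega
  · obtain ⟨x, y, he⟩ := hlink e
    have := numComponents_le_insert_add_one γ he
    omega
  · obtain ⟨x, y, he⟩ := hlink e
    have h1 := (numComponents_insert_eq_iff I he).1 (by omega)
    have h2 : (Quot.mk _ x : Components G J) = Quot.mk _ y :=
      congrArg (Quot.lift (Quot.mk _) fun _ _ ⟨f, hf, h⟩ => Quot.sound ⟨f, hIJ hf, h⟩ :
        Components G I → Components G J) h1
    rw [(numComponents_insert_eq_iff J he).2 h2]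

theorem loopNumber_eq {V E : Type*} (G : Graph V E) (γ : Finset E) :
    loopNumber G γ = γ.card - ((Nat.card G.vertexSet : ℤ) - numComponents G γ) := by
  rw [loopNumber]
  ring

theorem spanningForests_eq_rankBases {V E : Type*} [Fintype E] (G : Graph V E) :
    spanningForests G =
      rankBases fun γ : Finset E => (Nat.card G.vertexSet : ℤ) - numComponents G γ := by
  ext T
  simp only [spanningForests, rankBases, Set.mem_ofPred_eq, loopNumber]
  omega

theorem graphPolar_eq_polar {V E : Type*} [Fintype E] [DecidableEq E] (G : Graph V E) :
    graphPolar G = polar (spanningForests G) 4 (fun _ => 1) := by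
  have h : ∀ T : Finset E, signVector T = newtonVertex 4 (fun _ => 1) T := fun T => by
    ext e
    simp only [signVector, newtonVertex]
    split_ifs <;> norm_num
  simp only [graphPolar, polar, h]

end Instances

end Hepp

end

/-! ### The theorem for graphs and matroids -/

theorem mainTheorem1 :
    -- graphs that are p-log in four dimensions, with unit indices
    (∀ (V E : Type*) [Fintype E] [DecidableEq E] (G : Graph V E),
      G.vertexSet.Finite → G.edgeSet = Set.univ →
      Hepp.IsPLog (Hepp.loopNumber G) 4 (fun _ => 1) →
      ∀ i : E,
        Bornology.IsBounded (Hepp.graphPolar G ∩ {y | y i = 0}) ∧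
        IntegrableOn (Hepp.mellinIntegrand (Hepp.spanningForests G) 4 (fun _ => 1) i)
          (Hepp.positiveOrthant i) ∧
        Hepp.heppIntegral (Hepp.spanningForests G) 4 (fun _ => 1) i =
          ((Fintype.card E - 1).factorial : ℝ) * Hepp.sliceVolume (Hepp.graphPolar G) i ∧
        Hepp.heppBound (Hepp.loopNumber G) 4 (fun _ => 1) =
          ((Fintype.card E - 1).factorial : ℝ) * Hepp.sliceVolume (Hepp.graphPolar G) i) ∧
    -- connected matroids, with arbitrary indices
    (∀ (E : Type*) [Fintype E] [DecidableEq E] (M : Matroid E),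
      M.E = Set.univ → Hepp.IsConnected M →
      ∀ (i : E) (d : ℝ) (a : E → ℝ), 0 ≤ d →
        Hepp.sdc (Hepp.corank M) d a Finset.univ = 0 →
        (Hepp.IsPLog (Hepp.corank M) d a →
          Bornology.IsBounded (Hepp.polar (Hepp.bases M) d a ∩ {y | y i = 0})) ∧
        (Bornology.IsBounded (Hepp.polar (Hepp.bases M) d a ∩ {y | y i = 0}) →
          (∀ γ : Finset E, γ.Nonempty → γ ≠ Finset.univ →
            Hepp.sdc (Hepp.corank M) d a γ ≠ 0) ∧
          Hepp.heppBound (Hepp.corank M) d a =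
            ((Fintype.card E - 1).factorial : ℝ) *
              Hepp.sliceVolume (Hepp.polar (Hepp.bases M) d a) i ∧
          IntegrableOn (Hepp.mellinIntegrand (Hepp.bases M) d a i) (Hepp.positiveOrthant i) ∧
          Hepp.heppIntegral (Hepp.bases M) d a i =
            ((Fintype.card E - 1).factorial : ℝ) *
              Hepp.sliceVolume (Hepp.polar (Hepp.bases M) d a) i)) := by
  refine ⟨?_, ?_⟩
  · intro V E _ _ G hV hE h i
    have hr := Hepp.isRankFunction_graph G hV hE
    have hℓ := Hepp.loopNumber_eq G
    rw [Hepp.graphPolar_eq_polar, Hepp.spanningForests_eq_rankBases]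
    have hvol := Hepp.heppBound_eq_factorial_mul_sliceVolume hr hℓ (by norm_num) h i
    exact ⟨Hepp.isBounded_of_isPLog hr hℓ (by norm_num) h i,
      Hepp.integrableOn_mellinIntegrand hr hℓ (by norm_num) h i,
      (Hepp.heppIntegral_eq_heppBound hr hℓ (by norm_num) h i).trans hvol, hvol⟩
  · intro E _ _ M hM _ i d a hd h0
    have hr := Hepp.isRankFunction_eRk M
    have hℓ : ∀ γ, Hepp.corank M γ = γ.card - ((M.eRk γ).toNat : ℤ) := fun _ => rfl
    rw [Hepp.bases_eq_rankBases M hM]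
    refine ⟨fun h => Hepp.isBounded_of_isPLog hr hℓ hd h i, fun hb => ?_⟩
    have h := Hepp.isPLog_of_isBounded hr hℓ hd h0 i hb
    have hvol := Hepp.heppBound_eq_factorial_mul_sliceVolume hr hℓ hd h i
    exact ⟨fun γ hγ hγ' => (h.2 γ hγ hγ').ne', hvol,
      Hepp.integrableOn_mellinIntegrand hr hℓ hd h i,
      (Hepp.heppIntegral_eq_heppBound hr hℓ hd h i).trans hvol⟩
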